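/- Let $\mathcal G$ be a finite directed acyclic graph (DAG) whose vertex set is partitioned into observed and latent vertices, where no latent vertex has a parent. To each observed vertex $V$ associate a discrete (countable, non-empty) state space. The model defined by the observed margin of $\mathcal G$ is the set of all distributions of the observed variables of the form $$p(\text{observed})=\int \prod_{V} f(V\mid \mathrm{pa}_{\mathcal G}(V))\,dU ,$$ where the product is over all vertices, $\mathrm{pa}_{\mathcal G}(V)$ is the set of parents of $V$, the integral is over the latent variables $U$, each factor is a conditional probability density (a conditional probability mass function for observed $V$), and the latent variables may take values in arbitrary measurable spaces, with densities taken relative to arbitrary $\sigma$-finite reference measures. Let $X$ and $Y$ be two distinct observed vertices that are neither adjacent nor share a latent parent, such that the state spaces of $X$ and $Y$ each have at least two elements, and such that the graph $\mathcal G'$ obtained from $\mathcal G$ by adding the edge $X\to Y$ is again acyclic. Then the observed-margin model of $\mathcal G'$ is strictly larger than that of $\mathcal G$ (for the same observed state spaces): it contains every distribution in the model of $\mathcal G$, and at least one distribution that is not in it. In other words, $\mathcal G$ imposes a non-trivial (falsifiable) constraint on the observed distribution. -/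

import Mathlib

open MeasureTheory
open scoped ENNReal

universe uO uL uX uΩ

namespace LatentDAG

/-- A directed graph is acyclic if there is no directed path (of length at least one) from a
vertex to itself; in particular it has no loops. -/
def IsAcyclic {V : Type*} (G : Digraph V) : Prop :=
  ∀ v : V, ¬ Relation.TransGen G.Adj v v

/-- The directed graph obtained from `G` by adding the edge `a → b`. -/
def addEdge {V : Type*} (G : Digraph V) (a b : V) : Digraph V where
  Adj v w := G.Adj v w ∨ (v = a ∧ w = b)

section Model

variable {O : Type uO} {L : Type uL} [Fintype O] [Fintype L] [DecidableEq O] [DecidableEq L]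

/-- The vertex set is `O ⊕ L`, with `O` the observed and `L` the latent vertices. An observed vertex
`o` has the discrete state space `X o` (reference measure: counting measure) and a latent vertex `l`
has the measurable state space `Ω l` with reference measure `ν l`.

`IsCondDensities G X Ω ν f` says that `f` is a family of conditional densities
`f v = f(v | pa_G(v))`, one for each vertex `v`, written as functions of a full configuration
`(x, u)` of the observed and the latent variables. -/
structure IsCondDensities (G : Digraph (O ⊕ L)) (X : O → Type uX) (Ω : L → Type uΩ)
    [∀ l, MeasurableSpace (Ω l)] (ν : ∀ l, Measure (Ω l))
    (f : O ⊕ L → (∀ o, X o) → (∀ l, Ω l) → ℝ≥0∞) : Prop where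
  /-- Measurability (the observed coordinates are discrete). -/
  measurable : ∀ v x, Measurable (f v x)
  /-- `f v` is a function of the coordinate `v` and of the coordinates of the parents of `v`. -/
  local_dep : ∀ (v : O ⊕ L) (x x' : ∀ o, X o) (u u' : ∀ l, Ω l),
    (∀ o, (Sum.inl o = v ∨ G.Adj (Sum.inl o) v) → x o = x' o) →
    (∀ l, (Sum.inr l = v ∨ G.Adj (Sum.inr l) v) → u l = u' l) →
    f v x u = f v x' u'
  /-- For an observed vertex, `f o` is a probability mass function given each value of the
  parents. -/
  sum_eq_one : ∀ (o : O) (x : ∀ o, X o) (u : ∀ l, Ω l),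
    ∑' a : X o, f (Sum.inl o) (Function.update x o a) u = 1
  /-- For a latent vertex, `f l` is a probability density with respect to `ν l` given each value of
  the parents. -/
  lintegral_eq_one : ∀ (l : L) (x : ∀ o, X o) (u : ∀ l, Ω l),
    ∫⁻ t, f (Sum.inr l) x (Function.update u l t) ∂(ν l) = 1

/-- The model defined by the observed margin of `G`, for observed variables with discrete state
spaces `X o`: all distributions `p` of the observed variables such that, for some state spaces `Ω l`
of the latent variables (arbitrary measurable spaces with σ-finite reference measures) and some
conditional densities `f v = f(v | pa_G(v))`, the distribution `p` is the margin
`∫ ∏ v, f(v | pa_G(v)) du` of the joint distribution that factorizes according to `G`. -/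
def observedModel (G : Digraph (O ⊕ L)) (X : O → Type uX) : Set (PMF (∀ o, X o)) :=
  {p | ∃ (Ω : L → Type uΩ) (_ : ∀ l, MeasurableSpace (Ω l)) (ν : ∀ l, Measure (Ω l))
      (_ : ∀ l, SigmaFinite (ν l)) (f : O ⊕ L → (∀ o, X o) → (∀ l, Ω l) → ℝ≥0∞),
      IsCondDensities G X Ω ν f ∧
      ∀ x : ∀ o, X o, p x = ∫⁻ u, ∏ v : O ⊕ L, f v x u ∂(Measure.pi ν)}

end Model

end LatentDAG

/-!
Parentless latent variables can be taken to carry probability laws and drop out of the product of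
densities. Fix the values of all observed variables other than `a` and `b`, and bound the densities
of those other variables by `1`. What remains is the product of the density of `a` given its
parents and that of `b` given its parents. As `a` and `b` are not adjacent and share no latent
parent, these two factors are independent, so every slice of a distribution in the model of `G`
satisfies `p(s, t) ≤ A(s) * B(t)` for sub-probability mass functions `A` and `B`. By
Cauchy-Schwarz, `∑ s ∈ S, √p(s, φ s) ≤ 1` for every `φ` that is injective on `S`. With the edge
`a → b`, the variable `b` can be an arbitrary function of `a`, and the uniform distribution on two
cells that differ in both coordinates gives `√(1/2) + √(1/2) > 1`.
-/

namespace LatentDAG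

open Function ProbabilityTheory

section ProductMeasures

variable {ι : Type*} {E : ι → Type*}

theorem comp_updateFinset_comp_restrict [DecidableEq ι] {β : Type*} {F : (∀ i, E i) → β}
    {s : Finset ι} (hF : DependsOn F s) (z : ∀ i, E i) :
    (F ∘ updateFinset z s) ∘ s.restrict = F :=
  funext fun _ => hF fun i hi => by simp [updateFinset, Finset.mem_coe.1 hi]

variable [∀ i, MeasurableSpace (E i)] {μ : ∀ i, Measure (E i)}

theorem lmarginal_prod [∀ i, SigmaFinite (μ i)] [DecidableEq ι] {f : ∀ i, E i → ℝ≥0∞}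
    (hf : ∀ i, Measurable (f i)) (s : Finset ι) :
    ∫⋯∫⁻_s, (fun x => ∏ i ∈ s, f i (x i)) ∂μ = fun _ => ∏ i ∈ s, ∫⁻ t, f i t ∂(μ i) := by
  induction s using Finset.induction with
  | empty => simp
  | insert i s hi ih =>
    have inner : ∀ x : ∀ j, E j, ∫⁻ t, ∏ j ∈ insert i s, f j (update x i t j) ∂(μ i) =
        (∫⁻ t, f i t ∂(μ i)) * ∏ j ∈ s, f j (x j) := fun x => by
      rw [← lintegral_mul_const _ (hf i)]
      refine lintegral_congr fun t => ?_
      rw [Finset.prod_insert hi, update_self]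
      exact congrArg _ (Finset.prod_congr rfl fun j hj => by
        rw [update_of_ne (ne_of_mem_of_not_mem hj hi)])
    rw [lmarginal_insert' _ (by fun_prop) hi, funext inner]
    funext x
    rw [lmarginal, lintegral_const_mul _ (by fun_prop), Finset.prod_insert hi, ← congrFun ih x]
    rfl

variable [Fintype ι]

theorem lintegral_pi_prod [∀ i, SigmaFinite (μ i)] {f : ∀ i, E i → ℝ≥0∞}
    (hf : ∀ i, Measurable (f i)) :
    ∫⁻ x, ∏ i, f i (x i) ∂(Measure.pi μ) = ∏ i, ∫⁻ t, f i t ∂(μ i) := by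
  classical
  rcases isEmpty_or_nonempty (∀ i, E i) with hE | ⟨⟨x⟩⟩
  · obtain ⟨i, hi⟩ := isEmpty_pi.1 hE
    rw [lintegral_of_isEmpty, Finset.prod_eq_zero (Finset.mem_univ i) (lintegral_of_isEmpty _ _)]
  · rw [lintegral_eq_lmarginal_univ x, lmarginal_prod hf]

theorem pi_withDensity [∀ i, SigmaFinite (μ i)] {f : ∀ i, E i → ℝ≥0∞}
    (hf : ∀ i, Measurable (f i)) [∀ i, SigmaFinite ((μ i).withDensity (f i))] :
    Measure.pi (fun i => (μ i).withDensity (f i)) =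
      (Measure.pi μ).withDensity fun x => ∏ i, f i (x i) := by
  refine Measure.pi_eq (μ := fun i => (μ i).withDensity (f i)) fun s hs => ?_
  rw [withDensity_apply _ (MeasurableSet.univ_pi hs), Measure.restrict_pi_pi, lintegral_pi_prod hf]
  exact Finset.prod_congr rfl fun i _ => (withDensity_apply _ (hs i)).symm

theorem indepFun_pi_of_dependsOn [∀ i, IsProbabilityMeasure (μ i)] {β γ : Type*}
    [MeasurableSpace β] [MeasurableSpace γ] {F : (∀ i, E i) → β} {H : (∀ i, E i) → γ}
    (hF : Measurable F) (hH : Measurable H) {s t : Set ι} (hFs : DependsOn F s)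
    (hHt : DependsOn H t) (hst : Disjoint s t) : F ⟂ᵢ[Measure.pi μ] H := by
  classical
  obtain ⟨z⟩ : Nonempty (∀ i, E i) := nonempty_of_isProbabilityMeasure (Measure.pi μ)
  rw [← s.coe_toFinset] at hFs
  rw [← t.coe_toFinset] at hHt
  have hcoord : iIndepFun (fun i (x : ∀ i, E i) => x i) (Measure.pi μ) :=
    iIndepFun_pi (X := fun _ => id) fun _ => aemeasurable_id
  rw [← comp_updateFinset_comp_restrict hFs z, ← comp_updateFinset_comp_restrict hHt z]
  exact (hcoord.indepFun_finset _ _ (Set.disjoint_toFinset.2 hst) measurable_pi_apply).comp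
    (hF.comp measurable_updateFinset) (hH.comp measurable_updateFinset)

end ProductMeasures

section DiscreteProbability

theorem sum_sqrt_mul_le_one {α β : Type*} {A : α → ℝ≥0∞} {B : β → ℝ≥0∞} (hA : ∑' s, A s ≤ 1)
    (hB : ∑' t, B t ≤ 1) {S : Finset α} {φ : α → β} (hφ : Set.InjOn φ S) :
    ∑ s ∈ S, (A s * B (φ s)) ^ (2⁻¹ : ℝ) ≤ 1 := by
  classical
  have hAS : ∑ s ∈ S, A s ≤ 1 := (ENNReal.sum_le_tsum S).trans hA
  have hBS : ∑ s ∈ S, B (φ s) ≤ 1 := by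
    rw [← Finset.sum_image hφ]
    exact (ENNReal.sum_le_tsum _).trans hB
  have sq : ∀ r : ℝ≥0∞, (r ^ (2⁻¹ : ℝ)) ^ (2 : ℝ) = r := fun r =>
    ENNReal.rpow_inv_rpow two_ne_zero r
  calc ∑ s ∈ S, (A s * B (φ s)) ^ (2⁻¹ : ℝ)
    _ = ∑ s ∈ S, A s ^ (2⁻¹ : ℝ) * B (φ s) ^ (2⁻¹ : ℝ) := by
      simp only [ENNReal.mul_rpow_of_nonneg _ _ (inv_nonneg.2 (zero_le_two (α := ℝ)))]
    _ ≤ (∑ s ∈ S, A s) ^ (1 / 2 : ℝ) * (∑ s ∈ S, B (φ s)) ^ (1 / 2 : ℝ) := by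
      simpa only [sq] using ENNReal.inner_le_Lp_mul_Lq S (fun s => A s ^ (2⁻¹ : ℝ))
        (fun s => B (φ s) ^ (2⁻¹ : ℝ)) Real.HolderConjugate.two_two
    _ ≤ 1 := mul_le_one' (ENNReal.rpow_le_one hAS (by norm_num))
      (ENNReal.rpow_le_one hBS (by norm_num))

theorem one_lt_two_mul_sqrt_half : (1 : ℝ≥0∞) < 2 * 2⁻¹ ^ (2⁻¹ : ℝ) := by
  have hlt : (2⁻¹ : ℝ≥0∞) < 2⁻¹ ^ (2⁻¹ : ℝ) := by
    simpa only [ENNReal.rpow_one] using ENNReal.rpow_lt_rpow_of_exponent_gt (x := 2⁻¹) (y := 1)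
      (z := 2⁻¹) (by simp) (by simp) (by norm_num)
  rw [two_mul, ← ENNReal.inv_two_add_inv_two]
  exact ENNReal.add_lt_add hlt hlt

theorem pmf_map_apply_of_leftInverse {α β : Type*} [DecidableEq β] (q : PMF α) {r : β → α}
    {h : α → β} (hr : LeftInverse r h) (y : β) :
    q.map h y = if y = h (r y) then q (r y) else 0 := by
  rw [PMF.map_apply]
  exact (tsum_eq_single (r y) fun s hs => if_neg fun e => hs (by rw [e, hr])).trans (by congr)

end DiscreteProbability

section CondDensities

variable {O : Type uO} {L : Type uL} [DecidableEq O] [DecidableEq L]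
  {G : Digraph (O ⊕ L)} {X : O → Type uX} {Ω : L → Type uΩ} [∀ l, MeasurableSpace (Ω l)]
  {ν : ∀ l, Measure (Ω l)} {f : O ⊕ L → (∀ o, X o) → (∀ l, Ω l) → ℝ≥0∞}

/-- The law of the latent variable `l` given the remaining variables, the latter being read off the
reference configuration `(x, u)`. If `l` has no parents, the choice of `(x, u)` is immaterial. -/
noncomputable def latentLaw (ν : ∀ l, Measure (Ω l))
    (f : O ⊕ L → (∀ o, X o) → (∀ l, Ω l) → ℝ≥0∞) (x : ∀ o, X o) (u : ∀ l, Ω l) (l : L) :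
    Measure (Ω l) :=
  (ν l).withDensity fun t => f (Sum.inr l) x (update u l t)

namespace IsCondDensities

theorem mono {G' : Digraph (O ⊕ L)} (hle : G ≤ G') (hf : IsCondDensities G X Ω ν f) :
    IsCondDensities G' X Ω ν f where
  measurable := hf.measurable
  local_dep v x x' u u' hx hu := hf.local_dep v x x' u u'
    (fun o ho => hx o (ho.imp_right (hle ·))) fun l hl => hu l (hl.imp_right (hle ·))
  sum_eq_one := hf.sum_eq_one
  lintegral_eq_one := hf.lintegral_eq_one

theorem observed_le_one (hf : IsCondDensities G X Ω ν f) (o : O) (x : ∀ o, X o)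
    (u : ∀ l, Ω l) : f (Sum.inl o) x u ≤ 1 := by
  rw [← hf.sum_eq_one o x u]
  simpa only [update_eq_self] using
    ENNReal.le_tsum (f := fun s => f (Sum.inl o) (update x o s) u) (x o)

theorem observed_update_of_not_adj (hf : IsCondDensities G X Ω ν f) {a b : O} (hab : a ≠ b)
    (hadj : ¬ G.Adj (Sum.inl b) (Sum.inl a)) (x : ∀ o, X o) (t : X b) (u : ∀ l, Ω l) :
    f (Sum.inl a) (update x b t) u = f (Sum.inl a) x u := by
  refine hf.local_dep _ _ _ _ _ (fun o ho => update_of_ne ?_ _ _) fun _ _ => rfl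
  rintro rfl
  exact ho.elim (fun h => hab (Sum.inl.inj h).symm) hadj

theorem observed_dependsOn (hf : IsCondDensities G X Ω ν f) (o : O) (x : ∀ o, X o) :
    DependsOn (f (Sum.inl o) x) {l | G.Adj (Sum.inr l) (Sum.inl o)} := fun _ _ h =>
  hf.local_dep _ _ _ _ _ (fun _ _ => rfl) fun l hl => h l (hl.resolve_left Sum.inr_ne_inl)

theorem latent_eq_update (hf : IsCondDensities G X Ω ν f) {l : L}
    (hl : ∀ v, ¬ G.Adj v (Sum.inr l)) (x x' : ∀ o, X o) (u u' : ∀ l, Ω l) :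
    f (Sum.inr l) x u = f (Sum.inr l) x' (update u' l (u l)) := by
  refine hf.local_dep _ _ _ _ _ (fun o ho => absurd ho (by simp [hl])) fun m hm => ?_
  obtain rfl : m = l := Sum.inr.inj (hm.resolve_right (hl _))
  rw [update_self]

theorem isProbabilityMeasure_latentLaw (hf : IsCondDensities G X Ω ν f) (x : ∀ o, X o)
    (u : ∀ l, Ω l) (l : L) : IsProbabilityMeasure (latentLaw ν f x u l) :=
  ⟨by rw [latentLaw, withDensity_apply _ MeasurableSet.univ, setLIntegral_univ,
    hf.lintegral_eq_one]⟩

theorem tsum_lintegral_observed_le_one (hf : IsCondDensities G X Ω ν f)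
    (μ : Measure (∀ l, Ω l)) [IsProbabilityMeasure μ] (o : O) (x : ∀ o, X o) :
    ∑' s, ∫⁻ u, f (Sum.inl o) (update x o s) u ∂μ ≤ 1 :=
  tsum_le_of_sum_le' zero_le_one fun S => calc
    ∑ s ∈ S, ∫⁻ u, f (Sum.inl o) (update x o s) u ∂μ
    _ = ∫⁻ u, ∑ s ∈ S, f (Sum.inl o) (update x o s) u ∂μ :=
      (lintegral_finsetSum S fun _ _ => hf.measurable _ _).symm
    _ ≤ ∫⁻ _, 1 ∂μ := lintegral_mono fun u =>
      (ENNReal.sum_le_tsum S).trans_eq (hf.sum_eq_one o x u)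
    _ = 1 := by rw [lintegral_one, measure_univ]

theorem prod_observed_le_mul [Fintype O] (hf : IsCondDensities G X Ω ν f) {a b : O}
    (hab : a ≠ b) (x : ∀ o, X o) (u : ∀ l, Ω l) :
    ∏ o, f (Sum.inl o) x u ≤ f (Sum.inl a) x u * f (Sum.inl b) x u := by
  rw [← Finset.prod_pair (f := fun o => f (Sum.inl o) x u) hab]
  exact Finset.prod_le_prod_of_subset_of_le_one' (Finset.subset_univ _)
    fun o _ _ => hf.observed_le_one o x u

variable [Fintype L]

theorem lintegral_prod_eq_latentLaw [Fintype O] [∀ l, SigmaFinite (ν l)]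
    (hf : IsCondDensities G X Ω ν f) (hlatent : ∀ v l, ¬ G.Adj v (Sum.inr l))
    (x₀ : ∀ o, X o) (u₀ : ∀ l, Ω l) (x : ∀ o, X o) :
    ∫⁻ u, ∏ v, f v x u ∂(Measure.pi ν) =
      ∫⁻ u, ∏ o, f (Sum.inl o) x u ∂(Measure.pi (latentLaw ν f x₀ u₀)) := by
  have hσ : ∀ l, SigmaFinite (latentLaw ν f x₀ u₀ l) := fun l =>
    have := hf.isProbabilityMeasure_latentLaw x₀ u₀ l
    inferInstance
  have hlat : ∀ l, Measurable fun t => f (Sum.inr l) x₀ (update u₀ l t) := fun l =>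
    (hf.measurable _ _).comp (measurable_update u₀)
  have hprod : Measurable fun u : ∀ l, Ω l => ∏ l, f (Sum.inr l) x₀ (update u₀ l (u l)) :=
    Finset.measurable_prod _ fun l _ => (hlat l).comp (measurable_pi_apply l)
  unfold latentLaw at hσ ⊢
  rw [pi_withDensity hlat, lintegral_withDensity_eq_lintegral_mul _ hprod
    (Finset.measurable_prod _ fun o _ => hf.measurable _ _)]
  refine lintegral_congr fun u => ?_
  rw [Fintype.prod_sum_type, mul_comm, Pi.mul_apply]
  exact congrArg (· * _) <| Finset.prod_congr rfl fun l _ =>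
    hf.latent_eq_update (hlatent · l) x x₀ u u₀

theorem lintegral_observed_mul (hf : IsCondDensities G X Ω ν f) {a b : O}
    (hconf : ¬ ∃ l, G.Adj (Sum.inr l) (Sum.inl a) ∧ G.Adj (Sum.inr l) (Sum.inl b))
    (μ : ∀ l, Measure (Ω l)) [∀ l, IsProbabilityMeasure (μ l)] (x : ∀ o, X o) :
    ∫⁻ u, f (Sum.inl a) x u * f (Sum.inl b) x u ∂(Measure.pi μ) =
      (∫⁻ u, f (Sum.inl a) x u ∂(Measure.pi μ)) * ∫⁻ u, f (Sum.inl b) x u ∂(Measure.pi μ) :=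
  lintegral_mul_eq_lintegral_mul_lintegral_of_indepFun (hf.measurable _ _) (hf.measurable _ _) <|
    indepFun_pi_of_dependsOn (hf.measurable _ _) (hf.measurable _ _) (hf.observed_dependsOn a x)
      (hf.observed_dependsOn b x) (Set.disjoint_left.2 fun l ha hb => hconf ⟨l, ha, hb⟩)

end IsCondDensities

end CondDensities

section ObservedModel

variable {O : Type uO} {L : Type uL} [Fintype O] [Fintype L] [DecidableEq O] [DecidableEq L]
  {G : Digraph (O ⊕ L)} {X : O → Type uX}

theorem observedModel_mono {G' : Digraph (O ⊕ L)} (hle : G ≤ G') :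
    observedModel.{uO, uL, uX, uΩ} G X ⊆ observedModel.{uO, uL, uX, uΩ} G' X := by
  rintro p ⟨Ω, mΩ, ν, hν, f, hf, hp⟩
  exact ⟨Ω, mΩ, ν, hν, f, hf.mono hle, hp⟩

theorem exists_apply_update_update_le_mul (hlatent : ∀ v l, ¬ G.Adj v (Sum.inr l))
    {a b : O} (hab : a ≠ b) (hadj : ¬ G.Adj (Sum.inl a) (Sum.inl b))
    (hadj' : ¬ G.Adj (Sum.inl b) (Sum.inl a))
    (hconf : ¬ ∃ l, G.Adj (Sum.inr l) (Sum.inl a) ∧ G.Adj (Sum.inr l) (Sum.inl b))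
    {p : PMF (∀ o, X o)} (hp : p ∈ observedModel.{uO, uL, uX, uΩ} G X) (x : ∀ o, X o) :
    ∃ (A : X a → ℝ≥0∞) (B : X b → ℝ≥0∞), ∑' s, A s ≤ 1 ∧ ∑' t, B t ≤ 1 ∧
      ∀ s t, p (update (update x a s) b t) ≤ A s * B t := by
  obtain ⟨Ω, mΩ, ν, hν, f, hf, hp⟩ := hp
  rcases isEmpty_or_nonempty (∀ l, Ω l) with hΩ | ⟨⟨u₀⟩⟩
  · exact ⟨0, 0, by simp, by simp, fun s t => by rw [hp, lintegral_of_isEmpty]; exact zero_le⟩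
  have hμ := hf.isProbabilityMeasure_latentLaw x u₀
  let μ := Measure.pi (latentLaw ν f x u₀)
  refine ⟨fun s => ∫⁻ u, f (Sum.inl a) (update x a s) u ∂μ,
    fun t => ∫⁻ u, f (Sum.inl b) (update x b t) u ∂μ,
    hf.tsum_lintegral_observed_le_one μ a x, hf.tsum_lintegral_observed_le_one μ b x,
    fun s t => ?_⟩
  set y := update (update x a s) b t with hy
  have hya : ∀ u, f (Sum.inl a) y u = f (Sum.inl a) (update x a s) u :=
    hf.observed_update_of_not_adj hab hadj' _ t
  have hyb : ∀ u, f (Sum.inl b) y u = f (Sum.inl b) (update x b t) u := by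
    rw [hy, update_comm hab]
    exact hf.observed_update_of_not_adj hab.symm hadj _ s
  calc p y
    _ = ∫⁻ u, ∏ o, f (Sum.inl o) y u ∂μ := by
      rw [hp, hf.lintegral_prod_eq_latentLaw hlatent x u₀]
    _ ≤ ∫⁻ u, f (Sum.inl a) y u * f (Sum.inl b) y u ∂μ :=
      lintegral_mono fun u => hf.prod_observed_le_mul hab y u
    _ = (∫⁻ u, f (Sum.inl a) y u ∂μ) * ∫⁻ u, f (Sum.inl b) y u ∂μ :=
      hf.lintegral_observed_mul hconf _ y
    _ = _ := by simp only [hya, hyb]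

theorem sum_sqrt_apply_update_update_le_one (hlatent : ∀ v l, ¬ G.Adj v (Sum.inr l))
    {a b : O} (hab : a ≠ b) (hadj : ¬ G.Adj (Sum.inl a) (Sum.inl b))
    (hadj' : ¬ G.Adj (Sum.inl b) (Sum.inl a))
    (hconf : ¬ ∃ l, G.Adj (Sum.inr l) (Sum.inl a) ∧ G.Adj (Sum.inr l) (Sum.inl b))
    {p : PMF (∀ o, X o)} (hp : p ∈ observedModel.{uO, uL, uX, uΩ} G X) (x : ∀ o, X o)
    {S : Finset (X a)} {φ : X a → X b} (hφ : Set.InjOn φ S) :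
    ∑ s ∈ S, p (update (update x a s) b (φ s)) ^ (2⁻¹ : ℝ) ≤ 1 := by
  obtain ⟨A, B, hA, hB, hp⟩ :=
    exists_apply_update_update_le_mul hlatent hab hadj hadj' hconf hp x
  refine le_trans (Finset.sum_le_sum fun s _ => ?_) (sum_sqrt_mul_le_one hA hB hφ)
  exact ENNReal.rpow_le_rpow (hp s (φ s)) (by norm_num)

theorem mem_observedModel_of_eq_prod {k : O → (∀ o, X o) → ℝ≥0∞}
    (hdep : ∀ o, DependsOn (k o) {o' | o' = o ∨ G.Adj (Sum.inl o') (Sum.inl o)})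
    (hsum : ∀ o x, ∑' s, k o (update x o s) = 1) {p : PMF (∀ o, X o)}
    (hp : ∀ x, p x = ∏ o, k o x) : p ∈ observedModel.{uO, uL, uX, uΩ} G X := by
  refine ⟨fun _ => PUnit, fun _ => inferInstance, fun _ => Measure.dirac PUnit.unit,
    fun _ => inferInstance, fun v x _ => Sum.elim (k · x) 1 v,
    ⟨fun _ _ => measurable_const, ?_, fun o x _ => hsum o x, fun l x _ => by simp⟩,
    fun x => by simp [hp, Fintype.prod_sum_type]⟩
  rintro (o | l) x x' - - hx -
  · exact hdep o fun o' ho' => hx o' (ho'.imp_left (congrArg _))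
  · rfl

theorem map_mem_observedModel {a : O} (q : PMF (X a)) {h : X a → ∀ o, X o}
    (ha : ∀ s, h s a = s)
    (hG : ∀ o ≠ a, G.Adj (Sum.inl a) (Sum.inl o) ∨ ∀ s s', h s o = h s' o) :
    q.map h ∈ observedModel.{uO, uL, uX, uΩ} G X := by
  classical
  refine mem_observedModel_of_eq_prod
    (k := fun o x => if o = a then q (x a) else if x o = h (x a) o then 1 else 0)
    (fun o x x' hx => ?_) (fun o x => ?_) fun x => ?_
  · by_cases hoa : o = a
    · simp only [if_pos hoa, hx a (Or.inl hoa.symm)]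
    · have hh : h (x a) o = h (x' a) o := (hG o hoa).elim
        (fun hadj => by rw [hx a (Or.inr hadj)]) fun hc => hc _ _
      simp only [if_neg hoa, hx o (Or.inl rfl), hh]
  · by_cases hoa : o = a
    · subst hoa
      simp [q.tsum_coe]
    · simp [hoa, update_of_ne (Ne.symm hoa)]
  · have hx : x = h (x a) ↔ ∀ o ∈ Finset.univ.erase a, x o = h (x a) o := by
      rw [funext_iff]
      refine ⟨fun e o _ => e o, fun e o => ?_⟩
      by_cases hoa : o = a
      · rw [hoa, ha]
      · exact e o (Finset.mem_erase.2 ⟨hoa, Finset.mem_univ o⟩)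
    rw [pmf_map_apply_of_leftInverse (r := fun y : ∀ o, X o => y a) q ha,
      ← Finset.mul_prod_erase _ _ (Finset.mem_univ a), if_pos rfl,
      Finset.prod_congr rfl fun o ho => if_neg (Finset.ne_of_mem_erase ho), Finset.prod_ite_zero,
      Finset.prod_const_one, mul_ite, mul_one, mul_zero]
    by_cases e : x = h (x a)
    · rw [if_pos e, if_pos (hx.1 e)]
    · rw [if_neg e, if_neg (mt hx.2 e)]

end ObservedModel

end LatentDAG

open Function LatentDAG in
theorem corollary2_general {O : Type uO} {L : Type uL} [Fintype O] [Fintype L]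
    [DecidableEq O] [DecidableEq L] (G G' : Digraph (O ⊕ L)) (hle : G ≤ G')
    (hlatent : ∀ v l, ¬ G.Adj v (Sum.inr l)) {a b : O} (hab : a ≠ b)
    (hG' : G'.Adj (Sum.inl a) (Sum.inl b)) (hadj : ¬ G.Adj (Sum.inl a) (Sum.inl b))
    (hadj' : ¬ G.Adj (Sum.inl b) (Sum.inl a))
    (hconf : ¬ ∃ l, G.Adj (Sum.inr l) (Sum.inl a) ∧ G.Adj (Sum.inr l) (Sum.inl b))
    (X : O → Type uX) [∀ o, Nonempty (X o)] [Nontrivial (X a)] [Nontrivial (X b)] :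
    observedModel.{uO, uL, uX, uΩ} G X ⊂ observedModel.{uO, uL, uX, uΩ} G' X := by
  classical
  refine ⟨observedModel_mono hle, fun hsub => ?_⟩
  obtain ⟨s, s', hs⟩ := exists_pair_ne (X a)
  obtain ⟨t, t', ht⟩ := exists_pair_ne (X b)
  let x : ∀ o, X o := fun _ => Classical.arbitrary _
  let φ : X a → X b := fun c => if c = s then t else t'
  let h : X a → ∀ o, X o := fun c => update (update x a c) b (φ c)
  let q : PMF (X a) := PMF.uniformOfFinset {s, s'} ⟨s, by simp⟩
  have ha : ∀ c, h c a = c := fun c => by simp [h, hab]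
  have hp : q.map h ∈ observedModel G X := hsub <| map_mem_observedModel q ha fun o hoa => by
    by_cases hob : o = b
    · exact Or.inl (hob ▸ hG')
    · exact Or.inr fun c c' => by simp [h, hoa, hob]
  have hφ : Set.InjOn φ ({s, s'} : Finset (X a)) := by
    simp [Set.InjOn, φ, hs, hs.symm, ht, ht.symm]
  have hq : ∀ c ∈ ({s, s'} : Finset (X a)), q c = 2⁻¹ := fun c hc =>
    (PMF.uniformOfFinset_apply_of_mem _ hc).trans (by rw [Finset.card_pair hs, Nat.cast_two])
  have hhalf : ∀ c ∈ ({s, s'} : Finset (X a)), q.map h (h c) = 2⁻¹ := fun c hc => by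
    rw [pmf_map_apply_of_leftInverse (r := fun y : ∀ o, X o => y a) q ha, ha, if_pos rfl, hq c hc]
  have hsum := sum_sqrt_apply_update_update_le_one hlatent hab hadj hadj' hconf hp x hφ
  rw [Finset.sum_congr rfl fun c hc => congrArg (· ^ (2⁻¹ : ℝ)) (hhalf c hc), Finset.sum_const,
    Finset.card_pair hs, nsmul_eq_mul, Nat.cast_two] at hsum
  exact one_lt_two_mul_sqrt_half.not_ge hsum

/-- The vertices are `O ⊕ L` (observed, latent); `G` is a DAG whose latent vertices have no parents;
`a`, `b` are observed vertices, neither adjacent nor sharing a latent parent, such that adding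
`a → b` gives a DAG again. For all discrete state spaces of the observed variables (those of `a`, `b`
with at least two points) the observed model strictly grows. -/
theorem corollary2 {O : Type uO} {L : Type uL} [Fintype O] [Fintype L]
    [DecidableEq O] [DecidableEq L]
    (G : Digraph (O ⊕ L)) (hG : LatentDAG.IsAcyclic G)
    (hlatent : ∀ (v : O ⊕ L) (l : L), ¬ G.Adj v (Sum.inr l))
    (a b : O) (hab : a ≠ b)
    (hadj : ¬ G.Adj (Sum.inl a) (Sum.inl b) ∧ ¬ G.Adj (Sum.inl b) (Sum.inl a))
    (hconf : ¬ ∃ l : L, G.Adj (Sum.inr l) (Sum.inl a) ∧ G.Adj (Sum.inr l) (Sum.inl b))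
    (hG' : LatentDAG.IsAcyclic (LatentDAG.addEdge G (Sum.inl a) (Sum.inl b)))
    (X : O → Type uX) [∀ o, Countable (X o)] [∀ o, Nonempty (X o)]
    [Nontrivial (X a)] [Nontrivial (X b)] :
    LatentDAG.observedModel.{uO, uL, uX, uΩ} G X ⊂
      LatentDAG.observedModel.{uO, uL, uX, uΩ}
        (LatentDAG.addEdge G (Sum.inl a) (Sum.inl b)) X :=
  corollary2_general G _ (fun _ _ => Or.inl) hlatent hab (Or.inr ⟨rfl, rfl⟩) hadj.1 hadj.2 hconf X
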